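/- Let $G$ be a finite connected undirected multigraph with vertex set $V$ in which every edge $e$ has a weight $w(e)>0$. A spanning rooted forest of $G$ is a spanning subgraph of $G$ without cycles together with a choice of exactly one vertex, the root, in each of its connected components (trees); its weight is the product of the weights of its edges (equal to $1$ if there are none). For $i,j\in V$ let $f_{ij}$ be the sum of the weights of all spanning rooted forests of $G$ in which $i$ belongs to a tree rooted at $j$, and let $F=(f_{ij})_{i,j\in V}$. A path is a walk with pairwise distinct vertices; a single vertex is a path of length $0$. Then: 1. $F$ determines a transitional measure for $G$, that is, for all $i,j,k\in V$ the transition inequality $f_{ij}\,f_{jk}\le f_{ik}\,f_{jj}$ holds, and $f_{ij}\,f_{jk}=f_{ik}\,f_{jj}$ if and only if every path in $G$ from $i$ to $k$ contains $j$. 2. All entries of $F$ are positive, and the logarithmic distance corresponding to $F$, $$d(i,j)=\tfrac12\bigl(\ln f_{ii}+\ln f_{jj}-\ln f_{ij}-\ln f_{ji}\bigr),\qquad i,j\in V,$$ is a distance (metric) on $V$ that is graph-geodetic for $G$: for all $i,j,k\in V$, $d(i,j)+d(j,k)=d(i,k)$ if and only if every path in $G$ connecting $i$ and $k$ contains $j$.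 -/

import Mathlib

open scoped Graph

namespace Graph

variable {α β : Type*}

/-- A walk in the multigraph `G` from `u` to `v`: an alternating sequence of vertices and edges,
each edge joining the two vertices next to it. The sequence consisting of one vertex of `G` is a
walk of length `0`. -/
inductive Walk (G : Graph α β) : α → α → Type _
  | nil (u : α) (hu : u ∈ V(G)) : Walk G u u
  | cons {u v w : α} (e : β) (h : G.IsLink e u v) (p : Walk G v w) : Walk G u w

/-- The list of the vertices of a walk, in order, with repetitions. -/
def Walk.support {G : Graph α β} : {u v : α} → G.Walk u v → List α
  | _, _, .nil u _ => [u]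
  | u, _, .cons _ _ p => u :: p.support

/-- The list of the edges of a walk, in order, with repetitions. -/
def Walk.edges {G : Graph α β} : {u v : α} → G.Walk u v → List β
  | _, _, .nil _ _ => []
  | _, _, .cons e _ p => e :: p.edges

/-- A path is a walk all of whose vertices are distinct. -/
def Walk.IsPath {G : Graph α β} {u v : α} (p : G.Walk u v) : Prop :=
  p.support.Nodup

/-- A cycle is a closed walk of positive length without repeated edges, in which no vertex is
repeated except that the last one is the first one. A loop is a cycle of length `1`, and two
parallel edges form a cycle of length `2`. -/
def Walk.IsCycle {G : Graph α β} {u : α} (p : G.Walk u u) : Prop :=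
  p.edges ≠ [] ∧ p.edges.Nodup ∧ p.support.tail.Nodup

/-- `u` and `v` lie in the same connected component of `G`. -/
def Reachable (G : Graph α β) (u v : α) : Prop :=
  Nonempty (G.Walk u v)

/-- `G` is connected: it has a vertex, and any two vertices are joined by a walk. -/
def IsConnected (G : Graph α β) : Prop :=
  V(G).Nonempty ∧ ∀ u ∈ V(G), ∀ v ∈ V(G), G.Reachable u v

/-- A forest is a multigraph without cycles; its connected components are trees. -/
def IsForest (G : Graph α β) : Prop :=
  ∀ (u : α) (p : G.Walk u u), ¬ p.IsCycle

/-- `(H, R)` is a spanning rooted forest of `G`: `H` is a spanning subgraph of `G` that is a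
forest, and the set `R` of roots contains exactly one vertex of each tree of `H`. -/
structure IsSpanningRootedForest (G H : Graph α β) (R : Set α) : Prop where
  spanning : H ≤s G
  isForest : H.IsForest
  roots_subset : R ⊆ V(H)
  existsUnique_root : ∀ v ∈ V(H), ∃! r, r ∈ R ∧ H.Reachable v r

/-- The set of the spanning rooted forests of `G` in which the vertex `i` belongs to a tree rooted
at `j`. -/
def rootedForests (G : Graph α β) (i j : α) : Set (Graph α β × Set α) :=
  {p | G.IsSpanningRootedForest p.1 p.2 ∧ j ∈ p.2 ∧ p.1.Reachable i j}

/-- In a finite multigraph the sum in `forestMatrix` is a genuine finite sum. -/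
theorem finite_rootedForests (G : Graph α β) (hV : V(G).Finite) (hE : E(G).Finite) (i j : α) :
    (G.rootedForests i j).Finite := by
  refine Set.Finite.of_finite_image (f := fun p : Graph α β × Set α => (E(p.1), p.2))
    ((hE.finite_subsets.prod hV.finite_subsets).subset ?_) ?_
  · rintro _ ⟨p, hp, rfl⟩
    refine ⟨IsSubgraph.edgeSet_mono hp.1.spanning.le, ?_⟩
    exact hp.1.roots_subset.trans hp.1.spanning.le.1
  · rintro ⟨H, R⟩ hp ⟨H', R'⟩ hq h
    obtain ⟨hEE, rfl⟩ := Prod.mk.inj h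
    have hs := hp.1.spanning
    have hs' := hq.1.spanning
    have hV' : V(H) = V(H') := hs.vertexSet_eq.trans hs'.vertexSet_eq.symm
    have : H = H' := Compatible.ext hV' hEE (Compatible.of_le_le hs.le hs'.le)
    simp [this]

/-- The weight of a multigraph: the product of the weights of its edges (`1` if there are none). -/
noncomputable def weight (w : β → ℝ) (H : Graph α β) : ℝ :=
  ∏ᶠ e ∈ E(H), w e

/-- The matrix `F = (f_ij)`: the entry `f_ij` is the total weight of the spanning rooted forests
of `G` that have `i` belonging to a tree rooted at `j`. -/
noncomputable def forestMatrix (G : Graph α β) (w : β → ℝ) : Matrix V(G) V(G) ℝ :=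
  fun i j => ∑ᶠ p ∈ G.rootedForests i j, weight w p.1

/-- Every path of `G` from `i` to `k` contains `j`. -/
def EveryPathContains (G : Graph α β) (i j k : α) : Prop :=
  ∀ p : G.Walk i k, p.IsPath → j ∈ p.support

/-- `S` satisfies the transition inequality and the graph bottleneck identity w.r.t. `G`. -/
structure DeterminesTransitionalMeasure (G : Graph α β) (S : Matrix V(G) V(G) ℝ) : Prop where
  transition_inequality : ∀ i j k, S i j * S j k ≤ S i k * S j j
  bottleneck_identity :
    ∀ i j k : V(G), S i j * S j k = S i k * S j j ↔ G.EveryPathContains i j k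

/-- The function `d` on pairs of vertices is graph-geodetic for `G`. -/
def IsGraphGeodetic (G : Graph α β) (d : V(G) → V(G) → ℝ) : Prop :=
  ∀ i j k : V(G), d i j + d j k = d i k ↔ G.EveryPathContains i j k

end Graph

/-- The logarithmic transformation of a matrix with positive entries:
`d_ij = (h_ii + h_jj - h_ij - h_ji) / 2`, where `h_ij = ln s_ij`. -/
noncomputable def logDistance {V : Type*} (S : Matrix V V ℝ) (i j : V) : ℝ :=
  (Real.log (S i i) + Real.log (S j j) - Real.log (S i j) - Real.log (S j i)) / 2

/-- `d` is a distance (a metric) on `V`. -/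
structure IsDistance {V : Type*} (d : V → V → ℝ) : Prop where
  nonneg : ∀ i j, 0 ≤ d i j
  eq_zero_iff : ∀ i j, d i j = 0 ↔ i = j
  symm : ∀ i j, d i j = d j i
  triangle : ∀ i j k, d i k ≤ d i j + d j k

/-!
Let `L` be the weighted Laplacian matrix of `G` and `f > 0` the total weight of the spanning rooted
forests. The proof rests on the matrix forest theorem `(I + L) F = f I`
(`Graph.forestWeight_add_sum`) and on the minimum principle for the operator `I + L`
(`Graph.nonneg_of_add_sum_nonneg`, `Graph.eq_zero_of_isLink`).

For the matrix forest theorem, fix a vertex `i`. A rooted forest in which `i` is not a root is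
obtained in exactly one way from a rooted forest in which `i` is a root, by adding an edge that
joins `i` to another tree and dismissing the root `i` (`Graph.sum_forests_eq`). Under this operation
the vertices of the tree of `i` take over the root of the other end of the new edge, and all other
vertices keep their roots (`Graph.rootIndicator_addEdge`). Hence `f` and all entries of `F` become
sums over the rooted forests in which `i` is a root, and row `i` of the identity
`(I + L) F = f I` holds for each summand separately. The underlying facts about forests follow
from their description as the multigraphs all of whose edges are bridges (`Graph.isForest_iff`).

For the transition inequality, fix `j` and `k` and consider `u i = f_ik f_jj - f_ij f_jk`. Then
`u j = 0`, and away from `j` the function `(I + L) u` is `f f_jj` times the indicator of `k`, so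
`u ≥ 0` by the minimum principle. A zero of `u` other than `j` spreads to its neighbours, hence to
its whole component in `G - j`; this is impossible if the component contains `k`, where
`(I + L) u > 0`. If the component does not contain `k`, then the minimum principle applied to `-u`
on this component gives `u = 0` there. So `u i = 0` if and only if every path from `i` to `k`
contains `j` (`Graph.transitionDefect_eq_zero_iff`). The statements on the logarithmic distance
follow by taking logarithms of the transition inequalities from `i` to `k` and from `k` to `i`.
-/

/-! ### Walks and reachability -/

namespace Graph

variable {α β : Type*} {G H K : Graph α β} {u v x y i j k : α} {e : β}

namespace Walk

/-- A walk in a subgraph, regarded as a walk in the whole graph. -/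
def mapLe (h : H ≤ G) : {u v : α} → H.Walk u v → G.Walk u v
  | _, _, .nil u hu => .nil u (h.vertexSet_mono hu)
  | _, _, .cons e he p => .cons e (he.mono h) (p.mapLe h)

@[simp]
theorem support_mapLe (h : H ≤ G) (p : H.Walk u v) : (p.mapLe h).support = p.support := by
  induction p with
  | nil => rfl
  | cons e he p ih => simp [mapLe, support, ih]

@[simp]
theorem edges_mapLe (h : H ≤ G) (p : H.Walk u v) : (p.mapLe h).edges = p.edges := by
  induction p with
  | nil => rfl
  | cons e he p ih => simp [mapLe, edges, ih]

theorem start_mem_support (p : G.Walk u v) : u ∈ p.support := by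
  cases p <;> simp [support]

theorem end_mem_support (p : G.Walk u v) : v ∈ p.support := by
  induction p with
  | nil => simp [support]
  | cons e h p ih => simp [support, ih]

theorem edges_subset (p : G.Walk u v) : ∀ e ∈ p.edges, e ∈ E(G) := by
  induction p with
  | nil => simp [edges]
  | cons f h p ih => simpa [edges] using ⟨h.edge_mem, ih⟩

theorem mem_support_of_mem_edges (p : G.Walk u v) (h : G.IsLink e x y) (he : e ∈ p.edges) :
    x ∈ p.support := by
  induction p with
  | nil => simp [edges] at he
  | cons f hf p ih =>
    simp only [edges, support, List.mem_cons] at he ⊢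
    rcases he with rfl | he
    · rcases h.left_eq_or_eq hf with rfl | rfl
      · exact .inl rfl
      · exact .inr p.start_mem_support
    · exact .inr (ih he)

theorem exists_sublist_support_of_mem (p : G.Walk u v) (hx : x ∈ p.support) :
    ∃ q : G.Walk x v, q.support.Sublist p.support := by
  induction p with
  | nil a ha =>
    obtain rfl : x = a := by simpa [support] using hx
    exact ⟨.nil x ha, .refl _⟩
  | cons e h p ih =>
    by_cases hxp : x ∈ p.support
    · obtain ⟨q, hq⟩ := ih hxp
      exact ⟨q, hq.cons _⟩
    · simp only [support, List.mem_cons, hxp, or_false] at hx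
      subst hx
      exact ⟨.cons e h p, .refl _⟩

theorem exists_isPath (p : G.Walk u v) : ∃ q : G.Walk u v, q.IsPath := by
  induction p with
  | nil a ha => exact ⟨.nil a ha, by simp [IsPath, support]⟩
  | @cons a b c e h p ih =>
    obtain ⟨q, hq⟩ := ih
    by_cases ha : a ∈ q.support
    · obtain ⟨r, hr⟩ := q.exists_sublist_support_of_mem ha
      exact ⟨r, hr.nodup hq⟩
    · exact ⟨.cons e h q, List.nodup_cons.2 ⟨ha, hq⟩⟩

theorem IsPath.edges_nodup {p : G.Walk u v} (hp : p.IsPath) : p.edges.Nodup := by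
  induction p with
  | nil => simp [edges]
  | cons e h p ih =>
    obtain ⟨hu, hp⟩ := List.nodup_cons.1 hp
    exact List.nodup_cons.2 ⟨fun he ↦ hu (p.mem_support_of_mem_edges h he), ih hp⟩

end Walk

theorem IsLink.reachable (h : G.IsLink e u v) : G.Reachable u v :=
  ⟨.cons e h (.nil v h.right_mem)⟩

theorem IsLink.deleteEdges {f : β} (h : G.IsLink f u v) (hfe : f ≠ e) :
    (G.deleteEdges {e}).IsLink f u v := by
  simpa [deleteEdges_isLink] using ⟨h, hfe⟩

namespace Reachable

protected theorem refl (hu : u ∈ V(G)) : G.Reachable u u :=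
  ⟨.nil u hu⟩

theorem left_mem (h : G.Reachable u v) : u ∈ V(G) := by
  obtain ⟨p⟩ := h
  cases p with
  | nil _ hu => exact hu
  | cons e he p => exact he.left_mem

protected theorem trans (huv : G.Reachable u v) (hvx : G.Reachable v x) : G.Reachable u x := by
  obtain ⟨p⟩ := huv
  induction p with
  | nil => exact hvx
  | cons e h p ih =>
    obtain ⟨q⟩ := ih hvx
    exact ⟨.cons e h q⟩

protected theorem symm (h : G.Reachable u v) : G.Reachable v u := by
  obtain ⟨p⟩ := h
  induction p with
  | nil u hu => exact .refl hu
  | cons e h p ih => exact ih.trans h.symm.reachable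

theorem right_mem (h : G.Reachable u v) : v ∈ V(G) :=
  h.symm.left_mem

theorem mono (hHG : H ≤ G) (h : H.Reachable u v) : G.Reachable u v :=
  h.map (Walk.mapLe hHG)

end Reachable

theorem Walk.reachable_deleteEdges (p : G.Walk u v) (he : e ∉ p.edges) :
    (G.deleteEdges {e}).Reachable u v := by
  induction p with
  | nil u hu => exact .refl (by simpa using hu)
  | cons f h p ih =>
    simp only [edges, List.mem_cons, not_or] at he
    exact (h.deleteEdges (Ne.symm he.1)).reachable.trans (ih he.2)

theorem Walk.reachable_deleteVerts (p : G.Walk u v) (hj : j ∉ p.support) :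
    (G.deleteVerts {j}).Reachable u v := by
  induction p with
  | nil u hu => exact .refl (by simpa [hu, support, eq_comm] using hj)
  | cons f h p ih =>
    simp only [support, List.mem_cons, not_or] at hj
    have hne : ∀ z ∈ p.support, z ≠ j := fun z hz hzj ↦ hj.2 (hzj ▸ hz)
    have hf : (G.deleteVerts {j}).IsLink f _ _ :=
      (deleteVerts_isLink ..).2 ⟨h, fun hu ↦ hj.1 (Set.mem_singleton_iff.1 hu).symm,
        hne _ p.start_mem_support⟩
    exact hf.reachable.trans (ih hj.2)

theorem everyPathContains_iff :
    G.EveryPathContains i j k ↔ ¬ (G.deleteVerts {j}).Reachable i k := by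
  refine ⟨fun h ⟨p⟩ ↦ ?_, fun h p _ ↦ by_contra fun hj ↦ h (p.reachable_deleteVerts hj)⟩
  obtain ⟨q, hq⟩ := p.exists_isPath
  have hj := h (q.mapLe deleteVerts_le) (by simpa [Walk.IsPath] using hq)
  rw [Walk.support_mapLe] at hj
  obtain ⟨r, -⟩ := q.exists_sublist_support_of_mem hj
  have := Reachable.left_mem ⟨r⟩
  simp at this

theorem everyPathContains_comm : G.EveryPathContains i j k ↔ G.EveryPathContains k j i := by
  rw [everyPathContains_iff, everyPathContains_iff]
  exact not_congr ⟨.symm, .symm⟩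

/-! ### Forests and bridges -/

/-- Walks may be assumed to use a given edge at most once, in one of its two directions. -/
theorem IsLink.reachable_iff_deleteEdges (h : G.IsLink e x y) :
    G.Reachable u v ↔ (G.deleteEdges {e}).Reachable u v ∨
      ((G.deleteEdges {e}).Reachable u x ∧ (G.deleteEdges {e}).Reachable y v) ∨
      ((G.deleteEdges {e}).Reachable u y ∧ (G.deleteEdges {e}).Reachable x v) := by
  constructor
  · rintro ⟨p⟩
    have hx : (G.deleteEdges {e}).Reachable x x := .refl (by simpa using h.left_mem)
    have hy : (G.deleteEdges {e}).Reachable y y := .refl (by simpa using h.right_mem)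
    induction p with
    | nil u hu => exact .inl (.refl (by simpa using hu))
    | @cons a b c f hf p ih =>
      by_cases hfe : f = e
      · subst hfe
        rcases h.eq_and_eq_or_eq_and_eq hf with ⟨rfl, rfl⟩ | ⟨rfl, rfl⟩ <;> tauto
      · have hab : (G.deleteEdges {e}).Reachable a b :=
          (hf.deleteEdges hfe).reachable
        rcases ih with ih | ⟨h1, h2⟩ | ⟨h1, h2⟩
        · exact .inl (hab.trans ih)
        · exact .inr (.inl ⟨hab.trans h1, h2⟩)
        · exact .inr (.inr ⟨hab.trans h1, h2⟩)
  · rintro (h1 | ⟨h1, h2⟩ | ⟨h1, h2⟩)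
    · exact h1.mono deleteEdges_le
    · exact ((h1.mono deleteEdges_le).trans h.reachable).trans (h2.mono deleteEdges_le)
    · exact ((h1.mono deleteEdges_le).trans h.symm.reachable).trans (h2.mono deleteEdges_le)

/-- A multigraph is a forest if and only if each of its edges is a bridge. -/
theorem isForest_iff :
    G.IsForest ↔ ∀ e x y, G.IsLink e x y → ¬ (G.deleteEdges {e}).Reachable x y := by
  constructor
  · rintro hG e x y h hr
    obtain ⟨p⟩ := hr.symm
    obtain ⟨q, hq⟩ := p.exists_isPath
    refine hG x (.cons e h (q.mapLe deleteEdges_le)) ⟨by simp [Walk.edges], ?_, ?_⟩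
    · simp only [Walk.edges, Walk.edges_mapLe, List.nodup_cons]
      exact ⟨fun he ↦ by simpa using q.edges_subset e he, hq.edges_nodup⟩
    · simpa [Walk.support, Walk.IsPath] using hq
  · intro h u p hp
    have key : ∀ {v : α} (p : G.Walk u v), p.edges ≠ [] → p.edges.Nodup →
        ∃ e x, G.IsLink e u x ∧ (G.deleteEdges {e}).Reachable x v := by
      rintro v (_ | ⟨e, he, q⟩) h1 h2
      · simp [Walk.edges] at h1
      · exact ⟨e, _, he, q.reachable_deleteEdges (List.nodup_cons.1 h2).1⟩
    obtain ⟨e, x, he, hx⟩ := key p hp.1 hp.2.1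
    exact h e u x he hx.symm

theorem IsForest.mono (hHG : H ≤ G) (hG : G.IsForest) : H.IsForest := by
  rw [isForest_iff] at *
  exact fun e x y h hr ↦ hG e x y (h.mono hHG) (hr.mono (deleteEdges_mono_left hHG _))

theorem IsForest.not_reachable (hG : G.IsForest) (h : G.IsLink e x y) :
    ¬ (G.deleteEdges {e}).Reachable x y :=
  isForest_iff.1 hG e x y h

theorem deleteEdges_singleton_comm (G : Graph α β) (e f : β) :
    (G.deleteEdges {e}).deleteEdges {f} = (G.deleteEdges {f}).deleteEdges {e} := by
  rw [deleteEdges_deleteEdges, deleteEdges_deleteEdges, Set.union_comm]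

/-- Joining two distinct trees of a forest by an edge gives a forest. -/
theorem IsForest.of_deleteEdges (h : G.IsLink e x y) (hF : (G.deleteEdges {e}).IsForest)
    (hxy : ¬ (G.deleteEdges {e}).Reachable x y) : G.IsForest := by
  refine isForest_iff.2 fun f a b hf hr ↦ ?_
  by_cases hfe : f = e
  · subst hfe
    rcases h.eq_and_eq_or_eq_and_eq hf with ⟨rfl, rfl⟩ | ⟨rfl, rfl⟩
    · exact hxy hr
    · exact hxy hr.symm
  · have hf' : (G.deleteEdges {e}).IsLink f a b := hf.deleteEdges hfe
    have h' : (G.deleteEdges {f}).IsLink e x y := h.deleteEdges (Ne.symm hfe)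
    have hle : (G.deleteEdges {f}).deleteEdges {e} ≤ G.deleteEdges {e} :=
      deleteEdges_mono_left deleteEdges_le _
    rcases h'.reachable_iff_deleteEdges.1 hr with h1 | ⟨h1, h2⟩ | ⟨h1, h2⟩
    · exact hF.not_reachable hf' (deleteEdges_singleton_comm G f e ▸ h1)
    · exact hxy (((h1.mono hle).symm.trans hf'.reachable).trans (h2.mono hle).symm)
    · exact hxy ((h2.mono hle).trans (hf'.symm.reachable.trans (h1.mono hle)))

end Graph

/-! ### Attaching a tree of a rooted forest to another tree -/

namespace Graph

variable {α β : Type*} {G H K : Graph α β} {R : Set α} {u v x y i j k : α} {e : β}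

namespace IsSpanningRootedForest

theorem root_unique (h : G.IsSpanningRootedForest H R) (hx : x ∈ R) (hy : y ∈ R)
    (hxy : H.Reachable x y) : x = y :=
  (h.existsUnique_root x (h.roots_subset hx)).unique ⟨hx, .refl hxy.left_mem⟩ ⟨hy, hxy⟩

/-- If `i` is a root and `e` joins `i` to another tree, then adding `e` to the forest and
dismissing the root `i` gives a spanning rooted forest: the tree of `i` is attached to the tree at
the other end of `e`. -/
theorem of_deleteEdges (hK : K ≤s G) (he : K.IsLink e i k) (hi : i ∉ R)
    (hik : ¬ (K.deleteEdges {e}).Reachable i k)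
    (h : G.IsSpanningRootedForest (K.deleteEdges {e}) (insert i R)) :
    G.IsSpanningRootedForest K R where
  spanning := hK
  isForest := .of_deleteEdges he h.isForest hik
  roots_subset := by simpa using (Set.subset_insert i R).trans h.roots_subset
  existsUnique_root := by
    intro v hv
    refine existsUnique_of_exists_of_unique ?_ ?_
    · obtain ⟨s, hs, hvs⟩ := (h.existsUnique_root v (by simpa using hv)).exists
      rcases Set.mem_insert_iff.1 hs with rfl | hs
      · obtain ⟨t, ht, hkt⟩ := (h.existsUnique_root k (by simpa using he.right_mem)).exists
        rcases Set.mem_insert_iff.1 ht with rfl | ht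
        · exact absurd hkt.symm hik
        · exact ⟨t, ht, he.reachable_iff_deleteEdges.2 (.inr (.inl ⟨hvs, hkt⟩))⟩
      · exact ⟨s, hs, hvs.mono deleteEdges_le⟩
    · rintro a b ⟨ha, hva⟩ ⟨hb, hvb⟩
      have ha' : a ∈ insert i R := .inr ha
      have hb' : b ∈ insert i R := .inr hb
      rcases he.reachable_iff_deleteEdges.1 (hva.symm.trans hvb) with h1 | ⟨h1, h2⟩ | ⟨h1, h2⟩
      · exact h.root_unique ha' hb' h1
      · exact absurd (h.root_unique ha' (.inl rfl) h1 ▸ ha) hi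
      · exact absurd (h.root_unique (.inl rfl) hb' h2 ▸ hb) hi

/-- If `i` is not a root, then deleting the first edge of the path from `i` to its root and making
`i` a root gives a spanning rooted forest. -/
theorem exists_deleteEdges (h : G.IsSpanningRootedForest K R) (hiK : i ∈ V(K)) (hi : i ∉ R) :
    ∃ e k, K.IsLink e i k ∧ G.IsSpanningRootedForest (K.deleteEdges {e}) (insert i R) := by
  obtain ⟨r, hr, ⟨p⟩⟩ := (h.existsUnique_root i hiK).exists
  obtain ⟨q, hq⟩ := p.exists_isPath
  cases q with
  | nil => exact absurd hr hi
  | @cons _ k _ e he q =>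
    have hkr : (K.deleteEdges {e}).Reachable k r :=
      q.reachable_deleteEdges fun heq ↦
        (List.nodup_cons.1 hq).1 (q.mem_support_of_mem_edges he heq)
    have hik := h.isForest.not_reachable he
    refine ⟨e, k, he, ⟨⟨deleteEdges_le.trans h.spanning.le, ?_⟩, h.isForest.mono deleteEdges_le,
      ?_, fun v hv ↦ existsUnique_of_exists_of_unique ?_ ?_⟩⟩
    · simpa using h.spanning.vertexSet_eq
    · simpa using Set.insert_subset hiK h.roots_subset
    · obtain ⟨s, hs, hvs⟩ := (h.existsUnique_root v (by simpa using hv)).exists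
      rcases he.reachable_iff_deleteEdges.1 hvs with h1 | ⟨h1, -⟩ | ⟨h1, -⟩
      · exact ⟨s, .inr hs, h1⟩
      · exact ⟨i, .inl rfl, h1⟩
      · exact ⟨r, .inr hr, h1.trans hkr⟩
    · -- no root other than `i` is in the tree of `i`: it would be the old root `r`
      have key : ∀ b ∈ R, ¬ (K.deleteEdges {e}).Reachable i b := fun b hb hib ↦ by
        have hrb : K.Reachable r b :=
          (hkr.symm.mono deleteEdges_le).trans
            (he.symm.reachable.trans (hib.mono deleteEdges_le))
        obtain rfl := h.root_unique hr hb hrb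
        exact hik (hib.trans hkr.symm)
      rintro a b ⟨rfl | ha, hva⟩ ⟨rfl | hb, hvb⟩
      · rfl
      · exact absurd (hva.symm.trans hvb) (key b hb)
      · exact absurd (hvb.symm.trans hva) (key a ha)
      · exact h.root_unique ha hb ((hva.symm.trans hvb).mono deleteEdges_le)

/-- The edge by which the tree of the dismissed root `i` was attached is determined by the
resulting rooted forest. -/
theorem eq_of_deleteEdges (h : G.IsSpanningRootedForest K R) {e₁ e₂ : β} {k₁ k₂ : α}
    (he₁ : K.IsLink e₁ i k₁) (he₂ : K.IsLink e₂ i k₂)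
    (h₁ : G.IsSpanningRootedForest (K.deleteEdges {e₁}) (insert i R))
    (h₂ : G.IsSpanningRootedForest (K.deleteEdges {e₂}) (insert i R)) : e₁ = e₂ := by
  by_contra hne
  have hik₂ := h.isForest.not_reachable he₂
  obtain ⟨r, hr, hkr⟩ := (h₂.existsUnique_root k₂ (by simpa using he₂.right_mem)).exists
  have hir : i ≠ r := by
    rintro rfl
    exact hik₂ hkr.symm
  have he₁' : (K.deleteEdges {e₂}).IsLink e₁ i k₁ := he₁.deleteEdges hne
  have he₂' : (K.deleteEdges {e₁}).IsLink e₂ i k₂ := he₂.deleteEdges (Ne.symm hne)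
  rcases he₁'.reachable_iff_deleteEdges.1 hkr with h3 | ⟨h3, -⟩ | ⟨-, h3⟩
  · rw [deleteEdges_singleton_comm] at h3
    exact hir (h₁.root_unique (.inl rfl) hr (he₂'.reachable.trans (h3.mono deleteEdges_le)))
  · exact hik₂ (h3.mono deleteEdges_le).symm
  · exact hir (h₂.root_unique (.inl rfl) hr (h3.mono deleteEdges_le))

/-- When the tree of `i` is attached to the tree of `k`, the root of `k` becomes the root of all
vertices of the tree of `i`, and the other vertices keep their roots. -/
theorem root_iff_deleteEdges (he : K.IsLink e i k) (hi : i ∉ R)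
    (hik : ¬ (K.deleteEdges {e}).Reachable i k)
    (h : G.IsSpanningRootedForest (K.deleteEdges {e}) (insert i R)) :
    j ∈ R ∧ K.Reachable v j ↔ j ∈ insert i R ∧
      (((K.deleteEdges {e}).Reachable v i ∧ (K.deleteEdges {e}).Reachable k j) ∨
        (¬ (K.deleteEdges {e}).Reachable v i ∧ (K.deleteEdges {e}).Reachable v j)) := by
  constructor
  · rintro ⟨hj, hvj⟩
    refine ⟨.inr hj, ?_⟩
    have hij : ¬ (K.deleteEdges {e}).Reachable i j := fun hij ↦
      hi (h.root_unique (.inl rfl) (.inr hj) hij ▸ hj)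
    rcases he.reachable_iff_deleteEdges.1 hvj with h1 | h1 | ⟨-, h1⟩
    · exact .inr ⟨fun h2 ↦ hij (h2.symm.trans h1), h1⟩
    · exact .inl h1
    · exact absurd h1 hij
  · rintro ⟨rfl | hj, ⟨h1, h2⟩ | ⟨h1, h2⟩⟩
    · exact absurd h2.symm hik
    · exact absurd h2 h1
    · exact ⟨hj, he.reachable_iff_deleteEdges.2 (.inr (.inl ⟨h1, h2⟩))⟩
    · exact ⟨hj, h2.mono deleteEdges_le⟩

end IsSpanningRootedForest

/-- The multigraph obtained from the subgraph `H` of `G` by adding the edge `e` of `G`. -/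
def addEdge (G H : Graph α β) (e : β) : Graph α β :=
  G.restrict (insert e E(H))

theorem addEdge_isSpanningSubgraph : G.addEdge H e ≤s G :=
  ⟨restrict_le, rfl⟩

theorem IsLink.addEdge (h : G.IsLink e x y) : (G.addEdge H e).IsLink e x y :=
  ⟨.inl rfl, h⟩

theorem deleteEdges_addEdge (hH : H ≤s G) (he : e ∉ E(H)) :
    (G.addEdge H e).deleteEdges {e} = H := by
  refine (Compatible.of_le_le (deleteEdges_le.trans restrict_le) hH.le).ext ?_ ?_
  · simpa [addEdge] using hH.vertexSet_eq.symm
  · have := hH.le.edgeSet_mono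
    ext f
    simp only [edgeSet_deleteEdges, edgeSet_restrict, Set.mem_sdiff, Set.mem_inter_iff,
      Set.mem_insert_iff, Set.mem_singleton_iff]
    constructor
    · tauto
    · exact fun hf ↦ ⟨⟨this hf, .inr hf⟩, fun hfe ↦ he (hfe ▸ hf)⟩

theorem addEdge_deleteEdges (hK : K ≤s G) (he : e ∈ E(K)) :
    G.addEdge (K.deleteEdges {e}) e = K := by
  refine (Compatible.of_le_le restrict_le hK.le).ext ?_ ?_
  · simpa [addEdge] using hK.vertexSet_eq.symm
  · simp [hK.le.edgeSet_mono, he]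

theorem weight_eq_mul_deleteEdges (w : β → ℝ) (hK : E(K).Finite) (he : e ∈ E(K)) :
    weight w K = w e * weight w (K.deleteEdges {e}) := by
  have h : E(K) = insert e E(K.deleteEdges {e}) := by
    simp [he]
  rw [weight, weight, h, finprod_mem_insert _ (by simp) (hK.subset (by simp))]

end Graph

/-! ### The matrix forest theorem -/

namespace Graph

variable {α β : Type*} {G : Graph α β} {v i j k : α} {e : β}

theorem finite_isSpanningRootedForest (hV : V(G).Finite) (hE : E(G).Finite) :
    {p : Graph α β × Set α | G.IsSpanningRootedForest p.1 p.2}.Finite := by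
  refine Set.Finite.of_finite_image (f := fun p : Graph α β × Set α ↦ (E(p.1), p.2))
    ((hE.finite_subsets.prod hV.finite_subsets).subset ?_) ?_
  · rintro _ ⟨p, hp, rfl⟩
    exact ⟨hp.spanning.le.edgeSet_mono, hp.roots_subset.trans hp.spanning.le.vertexSet_mono⟩
  · rintro ⟨H, R⟩ hp ⟨H', R'⟩ hq h
    obtain ⟨hEE, rfl⟩ := Prod.mk.inj h
    have : H = H' := (Compatible.of_le_le hp.spanning.le hq.spanning.le).ext
      (hp.spanning.vertexSet_eq.trans hq.spanning.vertexSet_eq.symm) hEE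
    rw [this]

theorem finite_links (hV : V(G).Finite) (hE : E(G).Finite) (i : α) :
    {d : β × α | G.IsLink d.1 i d.2}.Finite :=
  (hE.prod hV).subset fun _ hd ↦ ⟨hd.edge_mem, hd.right_mem⟩

/-- The finite set of the spanning rooted forests of a finite multigraph. -/
noncomputable def forests (G : Graph α β) (hV : V(G).Finite) (hE : E(G).Finite) :
    Finset (Graph α β × Set α) :=
  (finite_isSpanningRootedForest hV hE).toFinset

/-- The edges of a finite multigraph at the vertex `i`, each paired with its other end. A loop at
`i` occurs once, with other end `i`. -/
noncomputable def linksAt (G : Graph α β) (hV : V(G).Finite) (hE : E(G).Finite) (i : α) :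
    Finset (β × α) :=
  (finite_links hV hE i).toFinset

/-- The total weight of all spanning rooted forests. -/
noncomputable def totalForestWeight (G : Graph α β) (hV : V(G).Finite) (hE : E(G).Finite)
    (w : β → ℝ) : ℝ :=
  ∑ p ∈ G.forests hV hE, weight w p.1

open Classical in
/-- The indicator of the event that, in the rooted forest `p`, the vertex `i` belongs to the tree
rooted at `j`. -/
noncomputable def rootIndicator (p : Graph α β × Set α) (i j : α) : ℝ :=
  if j ∈ p.2 ∧ p.1.Reachable i j then 1 else 0

/-- The entries of the forest matrix as finite sums, for arbitrary elements of `α`. -/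
noncomputable def forestWeight (G : Graph α β) (hV : V(G).Finite) (hE : E(G).Finite)
    (w : β → ℝ) (i j : α) : ℝ :=
  ∑ p ∈ G.forests hV hE, weight w p.1 * rootIndicator p i j

section

variable {hV : V(G).Finite} {hE : E(G).Finite} {w : β → ℝ}

@[simp]
theorem mem_forests {p : Graph α β × Set α} :
    p ∈ G.forests hV hE ↔ G.IsSpanningRootedForest p.1 p.2 := by
  simp [forests]

@[simp]
theorem mem_linksAt {d : β × α} : d ∈ G.linksAt hV hE i ↔ G.IsLink d.1 i d.2 := by
  simp [linksAt]

theorem forestMatrix_apply (hV : V(G).Finite) (hE : E(G).Finite) (i j : V(G)) :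
    G.forestMatrix w i j = G.forestWeight hV hE w i j := by
  classical
  have h : G.rootedForests i j = ↑((G.forests hV hE).filter
      fun p ↦ (j : α) ∈ p.2 ∧ p.1.Reachable i j) := by
    ext p
    simp [rootedForests]
  rw [forestMatrix, h, finsum_mem_coe_finset, Finset.sum_filter, forestWeight]
  refine Finset.sum_congr rfl fun p _ ↦ ?_
  simp [rootIndicator]

open Classical in
/-- The spanning rooted forests in which `i` is not a root arise, each exactly once, from those in
which `i` is a root, by attaching the tree of `i` to another tree by an edge at `i`. -/
theorem sum_forests_eq (hi : i ∈ V(G)) (g : Graph α β × Set α → ℝ) :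
    ∑ p ∈ G.forests hV hE, weight w p.1 * g p =
      ∑ p ∈ G.forests hV hE with i ∈ p.2, weight w p.1 * (g p +
        ∑ d ∈ G.linksAt hV hE i with ¬ p.1.Reachable i d.2,
          w d.1 * g (G.addEdge p.1 d.1, p.2 \ {i})) := by
  simp_rw [mul_add, Finset.sum_add_distrib, Finset.mul_sum]
  rw [← Finset.sum_filter_add_sum_filter_not (G.forests hV hE) (fun p ↦ i ∈ p.2)]
  congr 1
  rw [Finset.sum_sigma']
  symm
  -- an edge from `i` to another tree of the forest does not belong to the forest
  have key : ∀ x ∈ ((G.forests hV hE).filter fun p ↦ i ∈ p.2).sigma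
      (fun p ↦ (G.linksAt hV hE i).filter fun d ↦ ¬ p.1.Reachable i d.2),
      G.IsSpanningRootedForest x.1.1 x.1.2 ∧ i ∈ x.1.2 ∧ G.IsLink x.2.1 i x.2.2 ∧
      ¬ x.1.1.Reachable i x.2.2 ∧ (G.addEdge x.1.1 x.2.1).deleteEdges {x.2.1} = x.1.1 := by
    rintro ⟨⟨H, R⟩, ⟨e, k⟩⟩ hx
    simp only [Finset.mem_sigma, Finset.mem_filter, mem_forests, mem_linksAt] at hx
    obtain ⟨⟨hF, hR⟩, hl, hr⟩ := hx
    refine ⟨hF, hR, hl, hr, deleteEdges_addEdge hF.spanning fun he ↦ hr ?_⟩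
    exact ((hF.spanning.le.isLink_iff he).2 hl).reachable
  have key2 : ∀ x ∈ ((G.forests hV hE).filter fun p ↦ i ∈ p.2).sigma
      (fun p ↦ (G.linksAt hV hE i).filter fun d ↦ ¬ p.1.Reachable i d.2),
      G.IsSpanningRootedForest (G.addEdge x.1.1 x.2.1) (x.1.2 \ {i}) := by
    intro x hx
    obtain ⟨hF, hR, hl, hr, hd⟩ := key x hx
    refine .of_deleteEdges addEdge_isSpanningSubgraph hl.addEdge (by simp) (hd.symm ▸ hr) ?_
    rwa [hd, Set.insert_sdiff_singleton, Set.insert_eq_of_mem hR]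
  refine Finset.sum_bij (fun x _ ↦ (G.addEdge x.1.1 x.2.1, x.1.2 \ {i})) ?_ ?_ ?_ ?_
  · intro x hx
    simpa using key2 x hx
  · rintro ⟨⟨H₁, R₁⟩, ⟨e₁, k₁⟩⟩ hx₁ ⟨⟨H₂, R₂⟩, ⟨e₂, k₂⟩⟩ hx₂ heq
    have hF := key2 _ hx₁
    obtain ⟨hF₁, hR₁, hl₁, hr₁, hd₁⟩ := key _ hx₁
    obtain ⟨hF₂, hR₂, hl₂, hr₂, hd₂⟩ := key _ hx₂
    obtain ⟨h1, h2⟩ := Prod.mk.inj heq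
    dsimp only at *
    have hR : R₁ = R₂ := by
      rw [← Set.insert_eq_of_mem hR₁, ← Set.insert_eq_of_mem hR₂, ← Set.insert_sdiff_singleton,
        h2, Set.insert_sdiff_singleton]
    subst hR
    have he : e₁ = e₂ := by
      refine hF.eq_of_deleteEdges (i := i) hl₁.addEdge (k₂ := k₂) (h1 ▸ hl₂.addEdge) ?_ ?_
      · rwa [hd₁, Set.insert_sdiff_singleton, Set.insert_eq_of_mem hR₁]
      · rwa [h1, hd₂, Set.insert_sdiff_singleton, Set.insert_eq_of_mem hR₁]
    subst he
    obtain rfl := hl₁.right_unique hl₂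
    rw [h1, hd₂] at hd₁
    rw [hd₁]
  · rintro ⟨K, R⟩ hK
    simp only [Finset.mem_filter, mem_forests] at hK
    obtain ⟨hK, hiR⟩ := hK
    obtain ⟨e, k, he, hF⟩ := hK.exists_deleteEdges (by rwa [hK.spanning.vertexSet_eq]) hiR
    refine ⟨⟨(K.deleteEdges {e}, insert i R), (e, k)⟩, ?_, ?_⟩
    · simp only [Finset.mem_sigma, Finset.mem_filter, mem_forests, mem_linksAt]
      exact ⟨⟨hF, .inl rfl⟩, he.mono hK.spanning.le, hK.isForest.not_reachable he⟩
    · simp [addEdge_deleteEdges hK.spanning he.edge_mem, hiR]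
  · intro x hx
    obtain ⟨hF, hR, hl, hr, hd⟩ := key x hx
    have hfin : E(G.addEdge x.1.1 x.2.1).Finite :=
      hE.subset addEdge_isSpanningSubgraph.le.edgeSet_mono
    dsimp only
    rw [weight_eq_mul_deleteEdges w hfin hl.addEdge.edge_mem, hd]
    ring

open Classical in
/-- `IsSpanningRootedForest.root_iff_deleteEdges` in terms of indicators. -/
theorem rootIndicator_addEdge {p : Graph α β × Set α} (hp : G.IsSpanningRootedForest p.1 p.2)
    (hi : i ∈ p.2) (he : G.IsLink e i k) (hk : ¬ p.1.Reachable i k) :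
    rootIndicator (G.addEdge p.1 e, p.2 \ {i}) v j =
      if p.1.Reachable v i then rootIndicator p k j else rootIndicator p v j := by
  obtain ⟨H, R⟩ := p
  dsimp only at *
  have hd : (G.addEdge H e).deleteEdges {e} = H :=
    deleteEdges_addEdge hp.spanning fun h ↦ hk ((hp.spanning.le.isLink_iff h).2 he).reachable
  have hR : insert i (R \ {i}) = R := by
    rw [Set.insert_sdiff_singleton, Set.insert_eq_of_mem hi]
  have := IsSpanningRootedForest.root_iff_deleteEdges (v := v) (j := j) (R := R \ {i})
    (he.addEdge (H := H)) (by simp) (hd.symm ▸ hk) (G := G) (by rwa [hd, hR])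
  rw [hd, hR] at this
  simp only [rootIndicator, this]
  by_cases hv : H.Reachable v i <;> simp [hv]

open Classical in
theorem rootIndicator_of_reachable {p : Graph α β × Set α}
    (hp : G.IsSpanningRootedForest p.1 p.2) (hi : i ∈ p.2) (hv : p.1.Reachable v i) :
    rootIndicator p v j = if i = j then 1 else 0 := by
  simp only [rootIndicator]
  refine if_congr ⟨fun h ↦ hp.root_unique hi h.1 (hv.symm.trans h.2), ?_⟩ rfl rfl
  rintro rfl
  exact ⟨hi, hv⟩

open Classical in
/-- The matrix forest theorem `(I + L) F = f I`, where `L` is the weighted Laplacian matrix and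
`f` the total weight of the spanning rooted forests. -/
theorem forestWeight_add_sum (hi : i ∈ V(G)) (j : α) :
    G.forestWeight hV hE w i j + ∑ d ∈ G.linksAt hV hE i,
        w d.1 * (G.forestWeight hV hE w i j - G.forestWeight hV hE w d.2 j) =
      if i = j then G.totalForestWeight hV hE w else 0 := by
  have htot : G.totalForestWeight hV hE w = ∑ p ∈ G.forests hV hE with i ∈ p.2, weight w p.1 * (1 +
      ∑ d ∈ G.linksAt hV hE i with ¬ p.1.Reachable i d.2, w d.1 * 1) := by
    rw [← sum_forests_eq hi (fun _ ↦ 1)]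
    simp [totalForestWeight]
  -- `weight w p.1 * c p m` is the contribution to `f_mj` of `p` and of the forests that arise from
  -- `p` by attaching the tree of `i` to another tree
  obtain ⟨c, hc⟩ : ∃ c : Graph α β × Set α → α → ℝ, ∀ p m, c p m = rootIndicator p m j +
      ∑ d ∈ G.linksAt hV hE i with ¬ p.1.Reachable i d.2, w d.1 *
        if p.1.Reachable m i then rootIndicator p d.2 j else rootIndicator p m j :=
    ⟨_, fun _ _ ↦ rfl⟩
  have hf : ∀ m, G.forestWeight hV hE w m j =
      ∑ p ∈ G.forests hV hE with i ∈ p.2, weight w p.1 * c p m := by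
    intro m
    rw [forestWeight, sum_forests_eq hi (fun p ↦ rootIndicator p m j)]
    refine Finset.sum_congr rfl fun p hp ↦ ?_
    simp only [Finset.mem_filter, mem_forests] at hp
    rw [hc]
    congr 2
    refine Finset.sum_congr rfl fun d hd ↦ ?_
    simp only [Finset.mem_filter, mem_linksAt] at hd
    rw [rootIndicator_addEdge hp.1 hp.2 hd.1 hd.2]
  -- With `A` and `B` as below, `c p m` is `δ + B` for `m` in the tree of `i`, and otherwise `1 + A`
  -- times the indicator of `m` having root `j`.
  have hpt : ∀ p ∈ (G.forests hV hE).filter (fun p ↦ i ∈ p.2),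
      c p i + ∑ d ∈ G.linksAt hV hE i, w d.1 * (c p i - c p d.2) =
        (if i = j then 1 else 0) *
          (1 + ∑ d ∈ G.linksAt hV hE i with ¬ p.1.Reachable i d.2, w d.1 * 1) := by
    intro p hp
    simp only [Finset.mem_filter, mem_forests] at hp
    obtain ⟨hp, hip⟩ := hp
    have hii : p.1.Reachable i i := .refl (hp.roots_subset hip)
    set δ : ℝ := if i = j then 1 else 0
    set D := G.linksAt hV hE i
    set A := ∑ d ∈ D with ¬ p.1.Reachable i d.2, w d.1 with hA
    set B := ∑ d ∈ D with ¬ p.1.Reachable i d.2, w d.1 * rootIndicator p d.2 j with hB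
    have hci : c p i = δ + B := by
      simp only [hc, if_pos hii, rootIndicator_of_reachable hp hip hii, hB, δ, D]
    have hterm : ∀ d ∈ D, w d.1 * (c p i - c p d.2) =
        if ¬ p.1.Reachable i d.2 then
          w d.1 * (δ + B) - w d.1 * rootIndicator p d.2 j * (1 + A) else 0 := by
      intro d _
      by_cases hd : p.1.Reachable i d.2
      · have : c p d.2 = δ + B := by
          simp only [hc, if_pos hd.symm, rootIndicator_of_reachable hp hip hd.symm, hB, δ, D]
        simp [hd, this, hci]
      · have hd' : ¬ p.1.Reachable d.2 i := fun h ↦ hd h.symm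
        have : c p d.2 = rootIndicator p d.2 j * (1 + A) := by
          simp only [hc, if_neg hd', ← Finset.sum_mul]
          ring
        rw [if_pos hd, hci, this]
        ring
    rw [Finset.sum_congr rfl hterm, ← Finset.sum_filter, Finset.sum_sub_distrib,
      ← Finset.sum_mul, ← Finset.sum_mul, ← hA, ← hB, hci]
    simp only [mul_one, ← hA]
    ring
  have hsum : ∑ d ∈ G.linksAt hV hE i,
        w d.1 * (G.forestWeight hV hE w i j - G.forestWeight hV hE w d.2 j) =
      ∑ p ∈ G.forests hV hE with i ∈ p.2, weight w p.1 *
        ∑ d ∈ G.linksAt hV hE i, w d.1 * (c p i - c p d.2) := by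
    simp only [hf, ← Finset.sum_sub_distrib, Finset.mul_sum]
    rw [Finset.sum_comm]
    exact Finset.sum_congr rfl fun p _ ↦ Finset.sum_congr rfl fun d _ ↦ by ring
  have : (if i = j then G.totalForestWeight hV hE w else 0) =
      ∑ p ∈ G.forests hV hE with i ∈ p.2, weight w p.1 * ((if i = j then 1 else 0) *
          (1 + ∑ d ∈ G.linksAt hV hE i with ¬ p.1.Reachable i d.2, w d.1 * 1)) := by
    split_ifs
    · simpa using htot
    · simp
  rw [this, hsum, hf i, ← Finset.sum_add_distrib]
  exact Finset.sum_congr rfl fun p hp ↦ by rw [← hpt p hp, mul_add]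

end

end Graph

/-! ### Minimum principle and positivity -/

namespace Graph

variable {α β : Type*} {G : Graph α β} {i j k : α} {hV : V(G).Finite} {hE : E(G).Finite}
  {w : β → ℝ}

/-- Minimum principle for the operator `I + L`, `L` the weighted Laplacian: a function on which
the operator is nonnegative in `C`, and which is nonnegative at the neighbours of `C` outside `C`,
is nonnegative on `C`. -/
theorem nonneg_of_add_sum_nonneg (hw : ∀ e ∈ E(G), 0 < w e) {C : Set α} (hC : C ⊆ V(G))
    {u : α → ℝ} (hu : ∀ i ∈ C, 0 ≤ u i + ∑ d ∈ G.linksAt hV hE i, w d.1 * (u i - u d.2))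
    (hbd : ∀ i ∈ C, ∀ e k, G.IsLink e i k → k ∉ C → 0 ≤ u k) : ∀ i ∈ C, 0 ≤ u i := by
  intro i hi
  obtain ⟨m, hm, hmin⟩ := Set.exists_min_image C u (hV.subset hC) ⟨i, hi⟩
  refine le_trans ?_ (hmin i hi)
  by_contra! hneg
  refine (hu m hm).not_gt (add_neg_of_neg_of_nonpos hneg (Finset.sum_nonpos fun d hd ↦ ?_))
  rw [mem_linksAt] at hd
  refine mul_nonpos_of_nonneg_of_nonpos (hw _ hd.edge_mem).le (sub_nonpos.2 ?_)
  by_cases hdC : d.2 ∈ C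
  · exact hmin _ hdC
  · exact hneg.le.trans (hbd m hm _ _ hd hdC)

/-- Strong minimum principle: a nonnegative function on which `I + L` is nonnegative at a zero
vanishes at the neighbours of this zero. -/
theorem eq_zero_of_isLink (hw : ∀ e ∈ E(G), 0 < w e) {u : α → ℝ} (hu0 : ∀ i ∈ V(G), 0 ≤ u i)
    (hu : 0 ≤ u i + ∑ d ∈ G.linksAt hV hE i, w d.1 * (u i - u d.2)) (hi : u i = 0) {e : β}
    (he : G.IsLink e i k) : u k = 0 := by
  have hnonneg : ∀ d ∈ G.linksAt hV hE i, 0 ≤ w d.1 * u d.2 := fun d hd ↦ by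
    rw [mem_linksAt] at hd
    exact mul_nonneg (hw _ hd.edge_mem).le (hu0 _ hd.right_mem)
  have hsum : ∑ d ∈ G.linksAt hV hE i, w d.1 * u d.2 = 0 := by
    refine le_antisymm ?_ (Finset.sum_nonneg hnonneg)
    simpa [hi] using hu
  have := (Finset.sum_eq_zero_iff_of_nonneg hnonneg).1 hsum (e, k) (by simpa using he)
  exact (mul_eq_zero.1 this).resolve_left (hw _ he.edge_mem).ne'

theorem weight_pos (hw : ∀ e ∈ E(G), 0 < w e) {H : Graph α β} (hH : H ≤ G) : 0 < weight w H :=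
  finprod_mem_induction (0 < ·) one_pos (fun _ _ ↦ mul_pos) fun e he ↦ hw e (hH.edgeSet_mono he)

theorem rootIndicator_nonneg (p : Graph α β × Set α) (i j : α) : 0 ≤ rootIndicator p i j := by
  unfold rootIndicator
  split_ifs <;> norm_num

/-- The edgeless graph, with all vertices as roots, is a spanning rooted forest. -/
theorem isSpanningRootedForest_noEdge (G : Graph α β) :
    G.IsSpanningRootedForest (noEdge V(G) β) V(G) where
  spanning := ⟨by simp, rfl⟩
  isForest := isForest_iff.2 fun e x y h ↦ by simp at h
  roots_subset := subset_rfl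
  existsUnique_root := by
    intro v hv
    refine ⟨v, ⟨hv, .refl hv⟩, ?_⟩
    rintro y ⟨-, ⟨p⟩⟩
    cases p with
    | nil => rfl
    | cons e h p => simp at h

theorem forestWeight_nonneg (hw : ∀ e ∈ E(G), 0 < w e) (i j : α) :
    0 ≤ G.forestWeight hV hE w i j :=
  Finset.sum_nonneg fun _ hp ↦ mul_nonneg (weight_pos hw (mem_forests.1 hp).spanning.le).le
    (rootIndicator_nonneg ..)

theorem forestWeight_self_pos (hw : ∀ e ∈ E(G), 0 < w e) (hi : i ∈ V(G)) :
    0 < G.forestWeight hV hE w i i := by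
  refine Finset.sum_pos' (fun p hp ↦ mul_nonneg
    (weight_pos hw (mem_forests.1 hp).spanning.le).le (rootIndicator_nonneg ..))
    ⟨(noEdge V(G) β, V(G)), mem_forests.2 G.isSpanningRootedForest_noEdge, ?_⟩
  refine mul_pos (weight_pos hw G.isSpanningRootedForest_noEdge.spanning.le) ?_
  simp [rootIndicator, hi, Reachable.refl (G := noEdge V(G) β) (u := i) hi]

theorem totalForestWeight_pos (hw : ∀ e ∈ E(G), 0 < w e) :
    0 < G.totalForestWeight hV hE w :=
  Finset.sum_pos (fun _ hp ↦ weight_pos hw (mem_forests.1 hp).spanning.le)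
    ⟨(noEdge V(G) β, V(G)), mem_forests.2 G.isSpanningRootedForest_noEdge⟩

/-- A zero of a column of the forest matrix would spread along walks to its diagonal entry. -/
theorem forestWeight_pos (hw : ∀ e ∈ E(G), 0 < w e) (h : G.Reachable i j) :
    0 < G.forestWeight hV hE w i j := by
  refine (forestWeight_nonneg hw i j).lt_of_ne' fun h0 ↦ ?_
  obtain ⟨p⟩ := h
  induction p with
  | nil i hi => exact (forestWeight_self_pos hw hi).ne' h0
  | @cons a b c e he p ih =>
    refine ih (eq_zero_of_isLink (hV := hV) (hE := hE) (u := fun i ↦ G.forestWeight hV hE w i c)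
      hw (fun i _ ↦ forestWeight_nonneg hw i c) ?_ h0 he)
    rw [forestWeight_add_sum he.left_mem]
    split_ifs
    · exact (totalForestWeight_pos hw).le
    · exact le_rfl

/-! ### The transition inequality -/

/-- The defect of the transition inequality, as a function of `i`. -/
noncomputable def transitionDefect (G : Graph α β) (hV : V(G).Finite) (hE : E(G).Finite)
    (w : β → ℝ) (j k i : α) : ℝ :=
  G.forestWeight hV hE w i k * G.forestWeight hV hE w j j -
    G.forestWeight hV hE w i j * G.forestWeight hV hE w j k

theorem transitionDefect_self (j k : α) : G.transitionDefect hV hE w j k j = 0 := by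
  rw [transitionDefect]
  ring

open Classical in
/-- Away from `j`, the operator `I + L` takes the transition defect to a nonnegative multiple of
the indicator of `k`. -/
theorem transitionDefect_add_sum (hi : i ∈ V(G)) (hij : i ≠ j) :
    G.transitionDefect hV hE w j k i + ∑ d ∈ G.linksAt hV hE i,
        w d.1 * (G.transitionDefect hV hE w j k i - G.transitionDefect hV hE w j k d.2) =
      if i = k then G.totalForestWeight hV hE w * G.forestWeight hV hE w j j else 0 := by
  have hk := forestWeight_add_sum (hV := hV) (hE := hE) (w := w) hi k
  have hj := forestWeight_add_sum (hV := hV) (hE := hE) (w := w) hi j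
  rw [if_neg hij] at hj
  have hsum : ∑ d ∈ G.linksAt hV hE i,
        w d.1 * (G.transitionDefect hV hE w j k i - G.transitionDefect hV hE w j k d.2) =
      (∑ d ∈ G.linksAt hV hE i,
        w d.1 * (G.forestWeight hV hE w i k - G.forestWeight hV hE w d.2 k)) *
          G.forestWeight hV hE w j j -
      (∑ d ∈ G.linksAt hV hE i,
        w d.1 * (G.forestWeight hV hE w i j - G.forestWeight hV hE w d.2 j)) *
          G.forestWeight hV hE w j k := by
    rw [Finset.sum_mul, Finset.sum_mul, ← Finset.sum_sub_distrib]
    refine Finset.sum_congr rfl fun d _ ↦ ?_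
    simp only [transitionDefect]
    ring
  rw [← zero_mul (G.forestWeight hV hE w j j), ← ite_mul, ← hk, hsum, transitionDefect]
  linear_combination (-G.forestWeight hV hE w j k) * hj

theorem transitionDefect_add_sum_nonneg (hw : ∀ e ∈ E(G), 0 < w e) (hi : i ∈ V(G)) (hij : i ≠ j) :
    0 ≤ G.transitionDefect hV hE w j k i + ∑ d ∈ G.linksAt hV hE i,
      w d.1 * (G.transitionDefect hV hE w j k i - G.transitionDefect hV hE w j k d.2) := by
  rw [transitionDefect_add_sum hi hij]
  split_ifs
  · exact mul_nonneg (totalForestWeight_pos hw).le (forestWeight_nonneg hw j j)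
  · exact le_rfl

theorem transitionDefect_nonneg (hw : ∀ e ∈ E(G), 0 < w e) (hi : i ∈ V(G)) :
    0 ≤ G.transitionDefect hV hE w j k i := by
  by_cases hij : i = j
  · rw [hij, transitionDefect_self]
  · refine nonneg_of_add_sum_nonneg (hV := hV) (hE := hE) (C := V(G) \ {j}) hw Set.sdiff_subset
      (fun a ha ↦ transitionDefect_add_sum_nonneg hw ha.1 ha.2) (fun a ha e b hb hbC ↦ ?_) i
      ⟨hi, hij⟩
    obtain rfl : b = j := by simpa [hb.right_mem] using hbC
    rw [transitionDefect_self]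

theorem transitionDefect_eq_zero_iff (hw : ∀ e ∈ E(G), 0 < w e) (hi : i ∈ V(G)) (hj : j ∈ V(G)) :
    G.transitionDefect hV hE w j k i = 0 ↔ G.EveryPathContains i j k := by
  rw [everyPathContains_iff]
  constructor
  · -- a zero of the defect would spread from `i` to `k` in the complement of `j`
    rintro h0 ⟨p⟩
    induction p with
    | nil a ha =>
      simp only [vertexSet_deleteVerts, Set.mem_sdiff, Set.mem_singleton_iff] at ha
      have h1 := transitionDefect_add_sum (hV := hV) (hE := hE) (w := w) (k := a) ha.1 ha.2
      rw [if_pos rfl] at h1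
      have h2 : ∑ d ∈ G.linksAt hV hE a, w d.1 * (G.transitionDefect hV hE w j a a -
          G.transitionDefect hV hE w j a d.2) ≤ 0 := by
        refine Finset.sum_nonpos fun d hd ↦ ?_
        rw [mem_linksAt] at hd
        rw [h0, zero_sub, mul_neg, neg_nonpos]
        exact mul_nonneg (hw _ hd.edge_mem).le (transitionDefect_nonneg hw hd.right_mem)
      have h3 := mul_pos (totalForestWeight_pos (hV := hV) (hE := hE) hw)
        (forestWeight_self_pos (hV := hV) (hE := hE) hw hj)
      linarith
    | @cons a b c e he p ih =>
      obtain ⟨he, haj, hbj⟩ := (deleteVerts_isLink ..).1 he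
      exact ih he.right_mem (eq_zero_of_isLink (hV := hV) (hE := hE) hw
        (fun _ ↦ transitionDefect_nonneg hw)
        (transitionDefect_add_sum_nonneg hw he.left_mem haj) h0 he)
  · intro h
    by_cases hij : i = j
    · rw [hij, transitionDefect_self]
    refine le_antisymm ?_ (transitionDefect_nonneg hw hi)
    -- minimum principle for the negated defect on the component of `i` in the complement of `j`
    have hC : ∀ a, (G.deleteVerts {j}).Reachable i a → a ∈ V(G) ∧ a ≠ j := fun a ha ↦ by
      simpa using ha.right_mem
    have := nonneg_of_add_sum_nonneg (hV := hV) (hE := hE) (w := w)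
      (C := {a | (G.deleteVerts {j}).Reachable i a})
      (u := fun a ↦ -G.transitionDefect hV hE w j k a) hw (fun a ha ↦ (hC a ha).1)
      (fun a ha ↦ ?_) (fun a ha e b hb hbC ↦ ?_) i (.refl (by simpa using ⟨hi, hij⟩))
    · exact neg_nonneg.1 this
    · have h1 := transitionDefect_add_sum (hV := hV) (hE := hE) (w := w) (k := k)
        (hC a ha).1 (hC a ha).2
      rw [if_neg (by rintro rfl; exact h ha)] at h1
      simp only [← neg_sub', mul_neg, Finset.sum_neg_distrib]
      linarith
    · by_cases hbj : b = j
      · simp [hbj, transitionDefect_self]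
      · have hl : (G.deleteVerts {j}).IsLink e a b :=
          (deleteVerts_isLink ..).2 ⟨hb, (hC a ha).2, hbj⟩
        exact absurd (Reachable.trans ha hl.reachable) hbC

theorem determinesTransitionalMeasure_forestMatrix (hV : V(G).Finite) (hE : E(G).Finite)
    (hw : ∀ e ∈ E(G), 0 < w e) : G.DeterminesTransitionalMeasure (G.forestMatrix w) where
  transition_inequality i j k := by
    simp only [forestMatrix_apply hV hE]
    exact sub_nonneg.1 (transitionDefect_nonneg hw i.2)
  bottleneck_identity i j k := by
    rw [← transitionDefect_eq_zero_iff (hV := hV) (hE := hE) hw i.2 j.2]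
    simp only [forestMatrix_apply hV hE, transitionDefect]
    rw [sub_eq_zero, eq_comm]

theorem everyPathContains_self_iff (hi : i ∈ V(G)) : G.EveryPathContains i j i ↔ i = j := by
  constructor
  · intro h
    simpa [Walk.support, eq_comm] using h (.nil i hi) (by simp [Walk.IsPath, Walk.support])
  · rintro rfl p -
    exact p.start_mem_support

/-! ### The logarithmic distance -/

section

variable {S : Matrix V(G) V(G) ℝ}

/-- The defect of the triangle inequality for the logarithmic distance is the sum of the
logarithmic defects of the transition inequalities from `i` to `k` and from `k` to `i`. -/
theorem logDistance_add_sub (i j k : V(G)) :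
    logDistance S i j + logDistance S j k - logDistance S i k =
      ((Real.log (S i k) + Real.log (S j j) - (Real.log (S i j) + Real.log (S j k))) +
        (Real.log (S k i) + Real.log (S j j) - (Real.log (S k j) + Real.log (S j i)))) / 2 := by
  simp only [logDistance]
  ring

theorem DeterminesTransitionalMeasure.log_nonneg (h : G.DeterminesTransitionalMeasure S)
    (hpos : ∀ i j, 0 < S i j) (i j k : V(G)) :
    0 ≤ Real.log (S i k) + Real.log (S j j) - (Real.log (S i j) + Real.log (S j k)) := by
  rw [← Real.log_mul (hpos _ _).ne' (hpos _ _).ne', ← Real.log_mul (hpos _ _).ne' (hpos _ _).ne',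
    sub_nonneg]
  exact Real.log_le_log (mul_pos (hpos _ _) (hpos _ _)) (h.transition_inequality i j k)

theorem DeterminesTransitionalMeasure.log_eq_zero_iff (h : G.DeterminesTransitionalMeasure S)
    (hpos : ∀ i j, 0 < S i j) (i j k : V(G)) :
    Real.log (S i k) + Real.log (S j j) - (Real.log (S i j) + Real.log (S j k)) = 0 ↔
      G.EveryPathContains i j k := by
  rw [← Real.log_mul (hpos _ _).ne' (hpos _ _).ne', ← Real.log_mul (hpos _ _).ne' (hpos _ _).ne',
    sub_eq_zero, ← h.bottleneck_identity i j k, eq_comm (a := S i j * S j k)]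
  exact Real.log_injOn_pos.eq_iff (mul_pos (hpos _ _) (hpos _ _)) (mul_pos (hpos _ _) (hpos _ _))

theorem DeterminesTransitionalMeasure.isGraphGeodetic (h : G.DeterminesTransitionalMeasure S)
    (hpos : ∀ i j, 0 < S i j) : G.IsGraphGeodetic (logDistance S) := by
  intro i j k
  rw [← sub_eq_zero, logDistance_add_sub, div_eq_zero_iff, or_iff_left two_ne_zero,
    add_eq_zero_iff_of_nonneg (h.log_nonneg hpos i j k) (h.log_nonneg hpos k j i),
    h.log_eq_zero_iff hpos, h.log_eq_zero_iff hpos, everyPathContains_comm (i := (k : α)), and_self]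

theorem DeterminesTransitionalMeasure.isDistance (h : G.DeterminesTransitionalMeasure S)
    (hpos : ∀ i j, 0 < S i j) : IsDistance (logDistance S) := by
  have hsymm : ∀ i j, logDistance S i j = logDistance S j i := fun i j ↦ by
    simp only [logDistance]
    ring
  have hself : ∀ i, logDistance S i i = 0 := fun i ↦ by
    simp only [logDistance]
    ring
  have htri : ∀ i j k, logDistance S i k ≤ logDistance S i j + logDistance S j k := fun i j k ↦ by
    rw [← sub_nonneg, logDistance_add_sub]
    exact div_nonneg (add_nonneg (h.log_nonneg hpos i j k) (h.log_nonneg hpos k j i)) two_pos.le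
  refine ⟨fun i j ↦ ?_, fun i j ↦ ?_, hsymm, htri⟩
  · have := htri i j i
    rw [hself, hsymm j i] at this
    linarith
  · -- the geodetic property for `i`, `j`, `i`: the trivial path contains `j`
    have := h.isGraphGeodetic hpos i j i
    rw [hself, hsymm j i, everyPathContains_self_iff i.2, ← Subtype.ext_iff] at this
    rw [← this]
    constructor <;> intro <;> linarith

end

end Graph

theorem mainTheorem4 {α β : Type*} (G : Graph α β) (hV : V(G).Finite) (hE : E(G).Finite)
    (hG : G.IsConnected) (w : β → ℝ) (hw : ∀ e ∈ E(G), 0 < w e) :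
    G.DeterminesTransitionalMeasure (G.forestMatrix w) ∧
      (∀ i j, 0 < G.forestMatrix w i j) ∧
      IsDistance (logDistance (G.forestMatrix w)) ∧
      G.IsGraphGeodetic (logDistance (G.forestMatrix w)) := by
  have hS := Graph.determinesTransitionalMeasure_forestMatrix hV hE hw
  have hpos : ∀ i j, 0 < G.forestMatrix w i j := fun i j ↦ by
    rw [Graph.forestMatrix_apply hV hE]
    exact Graph.forestWeight_pos hw (hG.2 i i.2 j j.2)
  exact ⟨hS, hpos, hS.isDistance hpos, hS.isGraphGeodetic hpos⟩
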